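/- Let $X,Y$ be finite sets and $f:X\times Y\to\{0,1\}$. A \emph{1-fooling set} for $f$ is a set $F\subseteq X\times Y$ such that $f(x,y)=1$ for all $(x,y)\in F$, and for any two distinct pairs $(x,y),(x',y')\in F$ we have $f(x,y')=0$ or $f(x',y)=0$. Let $\mathrm{fool}^1(f)$ be the maximal size of a 1-fooling set for $f$. Let $Q_1^*(f)$ be the one-sided-error quantum communication complexity of $f$ with prior entanglement: the least number of qubits communicated by a quantum protocol in which Alice (with input $x$) and Bob (with input $y$) start from a fixed, input-independent shared state (possibly entangled, of arbitrary finite dimension) and exchange qubits, the order of the senders being fixed in advance, with the output obtained by measuring the last qubit sent over the channel in the computational basis, such that on every input with $f(x,y)=0$ the output is always $0$, and on every input with $f(x,y)=1$ the output is $1$ with probability at least $1/2$. Then, for every $f:X\times Y\to\{0,1\}$ (with logarithm to base $2$), $$Q_1^*(f)\;\geq\;\frac14\log_2 \mathrm{fool}^1(f)-\frac12 .$$ (If $f\equiv 0$, so that $\mathrm{fool}^1(f)=0$, one may read $\log_2 0$ as $0$ or as $-\infty$; the bound holds trivially.) -/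

import Mathlib

open scoped Kronecker

noncomputable section

namespace QComm

universe u v

variable {X : Type u} {Y : Type v}

/-! ### Fooling sets -/

/-- `F` is a 1-fooling set for `f`: every pair in `F` is a 1-input, and crossing two different
pairs of `F` gives at least one 0-input. -/
def IsOneFoolingSet (f : X × Y → Bool) (F : Finset (X × Y)) : Prop :=
  (∀ p ∈ F, f p = true) ∧
    ∀ p ∈ F, ∀ p' ∈ F, p ≠ p' → f (p.1, p'.2) = false ∨ f (p'.1, p.2) = false

/-- The maximal size of a 1-fooling set for `f` (used for finite `X` and `Y`, where the set of
sizes is bounded; it contains `0` because the empty set is a 1-fooling set). -/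
def fool1 (f : X × Y → Bool) : ℕ :=
  sSup {N : ℕ | ∃ F : Finset (X × Y), IsOneFoolingSet f F ∧ F.card = N}

/-! ### Quantum protocols with prior entanglement -/

/-- Isometries `ℂ^ι → ℂ^κ`, as matrices `V` with `V† V = 1`.  These are the local operations of a
party: a unitary on the party's registers together with fresh ancillas (measurements made during
the protocol are deferred in the usual way). -/
def LocalIsometry (ι κ : Type) [Fintype κ] [DecidableEq ι] : Type :=
  {V : Matrix κ ι ℂ // V.conjTranspose * V = 1}

/-- The state `(V ⊗ I) ψ` after Alice has applied an isometry from her `m`-dimensional register to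
an `m'`-dimensional register and one qubit that she puts on the channel.  The registers are listed
in the order Alice, channel, Bob. -/
def alicePuts {m n m' : ℕ} (V : LocalIsometry (Fin m) (Fin m' × Fin 2))
    (ψ : Fin m × Fin n → ℂ) : Fin m' × Fin 2 × Fin n → ℂ :=
  fun r => ((V.1 ⊗ₖ (1 : Matrix (Fin n) (Fin n) ℂ)).mulVec ψ) ((r.1, r.2.1), r.2.2)

/-- The state `(I ⊗ W) ψ` after Bob has applied an isometry from his `n`-dimensional register to
one qubit that he puts on the channel and an `n'`-dimensional register. -/
def bobPuts {m n n' : ℕ} (W : LocalIsometry (Fin n) (Fin 2 × Fin n'))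
    (ψ : Fin m × Fin n → ℂ) : Fin m × Fin 2 × Fin n' → ℂ :=
  ((1 : Matrix (Fin m) (Fin m) ℂ) ⊗ₖ W.1).mulVec ψ

/-- Bob takes the qubit from the channel and applies an isometry to it and his own register. -/
def bobTakes {m n n' : ℕ} (R : LocalIsometry (Fin 2 × Fin n) (Fin n'))
    (φ : Fin m × Fin 2 × Fin n → ℂ) : Fin m × Fin n' → ℂ :=
  ((1 : Matrix (Fin m) (Fin m) ℂ) ⊗ₖ R.1).mulVec φ

/-- Alice takes the qubit from the channel and applies an isometry to it and her own register. -/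
def aliceTakes {m n m' : ℕ} (R : LocalIsometry (Fin m × Fin 2) (Fin m'))
    (φ : Fin m × Fin 2 × Fin n → ℂ) : Fin m' × Fin n → ℂ :=
  (R.1 ⊗ₖ (1 : Matrix (Fin n) (Fin n) ℂ)).mulVec (fun r => φ (r.1.1, r.1.2, r.2))

/-- The probability of outcome `1` when the channel qubit of `φ` is measured in the computational
basis. -/
def probChannelOne {m n : ℕ} (φ : Fin m × Fin 2 × Fin n → ℂ) : ℝ :=
  ∑ a : Fin m, ∑ b : Fin n, ‖φ (a, 1, b)‖ ^ 2

/-- `Rounds X Y q m n`: instructions for the communication of `q` qubits, starting with an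
`m`-dimensional register of Alice and an `n`-dimensional register of Bob.  Every constructor sends
one qubit.  The order of the senders is fixed in advance but otherwise arbitrary; Alice's operations
depend on her input `x : X` only and Bob's on his input `y : Y` only.  The last qubit on the channel
is the output qubit. -/
inductive Rounds (X : Type u) (Y : Type v) : ℕ → ℕ → ℕ → Type (max u v)
  /-- Alice sends the last qubit. -/
  | aliceLast {m n m' : ℕ} (S : X → LocalIsometry (Fin m) (Fin m' × Fin 2)) : Rounds X Y 1 m n
  /-- Bob sends the last qubit. -/
  | bobLast {m n n' : ℕ} (S : Y → LocalIsometry (Fin n) (Fin 2 × Fin n')) : Rounds X Y 1 m n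
  /-- Alice sends a qubit to Bob, and the communication continues. -/
  | aliceSends {q m n m' n' : ℕ} (S : X → LocalIsometry (Fin m) (Fin m' × Fin 2))
      (R : Y → LocalIsometry (Fin 2 × Fin n) (Fin n')) (rest : Rounds X Y q m' n') :
      Rounds X Y (q + 1) m n
  /-- Bob sends a qubit to Alice, and the communication continues. -/
  | bobSends {q m n m' n' : ℕ} (S : Y → LocalIsometry (Fin n) (Fin 2 × Fin n'))
      (R : X → LocalIsometry (Fin m × Fin 2) (Fin m')) (rest : Rounds X Y q m' n') :
      Rounds X Y (q + 1) m n

/-- The probability that the measurement of the last qubit on the channel gives `1`, on inputs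
`x, y` and from the joint state `ψ`. -/
def Rounds.acceptProb (x : X) (y : Y) :
    {q m n : ℕ} → Rounds X Y q m n → (Fin m × Fin n → ℂ) → ℝ
  | _, _, _, .aliceLast S, ψ => probChannelOne (alicePuts (S x) ψ)
  | _, _, _, .bobLast S, ψ => probChannelOne (bobPuts (S y) ψ)
  | _, _, _, .aliceSends S R rest, ψ =>
      rest.acceptProb x y (bobTakes (R y) (alicePuts (S x) ψ))
  | _, _, _, .bobSends S R rest, ψ =>
      rest.acceptProb x y (aliceTakes (R x) (bobPuts (S y) ψ))

/-- A quantum protocol with prior entanglement and `q` qubits of communication: a fixed shared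
bipartite pure starting state, of any finite dimension and independent of the inputs, and
instructions for the communication.  (A mixed starting state can be purified.) -/
structure EntangledProtocol (X : Type u) (Y : Type v) (q : ℕ) where
  dimA : ℕ
  dimB : ℕ
  state : Fin dimA × Fin dimB → ℂ
  state_norm : ∑ r, ‖state r‖ ^ 2 = 1
  rounds : Rounds X Y q dimA dimB

/-- The probability that the protocol outputs `1` on inputs `x, y`. -/
def EntangledProtocol.acceptProb {q : ℕ} (P : EntangledProtocol X Y q) (x : X) (y : Y) : ℝ :=
  P.rounds.acceptProb x y P.state

/-- `P` computes `f` with one-sided error: it always outputs `0` on 0-inputs, and outputs `1` with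
probability at least `1/2` on 1-inputs. -/
def EntangledProtocol.ComputesOneSided {q : ℕ} (P : EntangledProtocol X Y q)
    (f : X × Y → Bool) : Prop :=
  ∀ x y, (f (x, y) = false → P.acceptProb x y = 0) ∧ (f (x, y) = true → 1 / 2 ≤ P.acceptProb x y)

/-- The one-sided-error quantum communication complexity of `f` with prior entanglement: the least
number of qubits of communication of a protocol that computes `f` with one-sided error (it would be
`⊤` if there were no such protocol). -/
def Q1star (f : X × Y → Bool) : ℕ∞ :=
  ⨅ (q : ℕ) (_ : ∃ P : EntangledProtocol X Y q, P.ComputesOneSided f), (q : ℕ∞)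

end QComm

end

/-!
A protocol with `q` qubits accepts `(x, y)` with an amplitude that is a sum of product operators
`A_h(x) ⊗ B_h(y)` applied to the shared state, one for each transcript `h` of computational basis
values on the channel (`Rounds.exists_hasAmplitudes`).  Tensoring the state with the unnormalised
maximally entangled state on pairs of transcripts turns the sum into one product operator
(`blockRow_mul_kronecker_mul`).  Writing the state as a matrix `M`, the amplitude is a matrix
`T(x, y) = A_x * M * B_yᵀ`, its squared Frobenius norm is the acceptance probability, and
`‖A_x‖² ‖B_y‖² ‖M‖²` is at most `4 ^ q`: each sent qubit doubles the squared norm of the sender's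
block row and the number of transcripts.  This is a postselected form of teleportation.

For a fooling set `(x_i, y_i)`, running two copies with the parties' roles exchanged in the second
gives the amplitudes `T(x_i, y_j) ⊗ T(x_j, y_i)ᵀ = C_i * (M ⊗ Mᵀ) * D_jᵀ`.  These vanish for
`i ≠ j`, since one-sided error makes one of the two factors zero, and have squared norm at least
`1 / 4` for `i = j`.

The entanglement dimension is unbounded, so a rank argument is not available; instead
`sum_frobSq_triangular_le` shows that if `C_i * M * D_jᵀ = 0` for all `i < j`, then
`∑ i, ‖C_i * M * D_iᵀ‖²` is at most `α * β * ‖M‖²`, where `α` and `β` bound the squared norms of the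
operators.  Replacing `M` by its projection to the kernel of the first operator leaves the other
diagonal blocks unchanged and lowers `α * ‖M‖²` by at least `‖C_0 * M‖²`, so induction applies.  A
fooling set of size `N` therefore satisfies `N / 4 ≤ (4 ^ q) ^ 2`.
-/

open scoped Kronecker

noncomputable section

namespace QComm

universe u v

/-! ### Squared norms of vectors and matrices -/

section Norms

open Matrix

variable {ι κ μ ν : Type*} [Fintype ι] [Fintype κ] [Fintype μ] [Fintype ν]

/-- The squared Euclidean norm of a complex vector. -/
def normSq (v : ι → ℂ) : ℝ := ∑ i, ‖v i‖ ^ 2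

/-- The squared Frobenius norm of a complex matrix. -/
def frobSq (M : Matrix κ ι ℂ) : ℝ := ∑ i, ∑ j, ‖M i j‖ ^ 2

/-- The squared operator norm of `A` is at most `α`. -/
def SqBound (A : Matrix κ ι ℂ) (α : ℝ) : Prop := ∀ v, normSq (A *ᵥ v) ≤ α * normSq v

lemma frobSq_nonneg (M : Matrix κ ι ℂ) : 0 ≤ frobSq M :=
  Finset.sum_nonneg fun _ _ => Finset.sum_nonneg fun _ _ => by positivity

lemma frobSq_eq_sum_col (M : Matrix κ ι ℂ) : frobSq M = ∑ j, normSq (fun i => M i j) :=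
  Finset.sum_comm

lemma frobSq_transpose (M : Matrix κ ι ℂ) : frobSq Mᵀ = frobSq M :=
  Finset.sum_comm

lemma frobSq_kronecker (M : Matrix κ ι ℂ) (M' : Matrix μ ν ℂ) :
    frobSq (M ⊗ₖ M') = frobSq M * frobSq M' := by
  simp only [frobSq, Fintype.sum_prod_type, kroneckerMap_apply, norm_mul, mul_pow]
  simp only [← Finset.mul_sum, ← Finset.sum_mul]

lemma frobSq_mul_le {A : Matrix κ ι ℂ} {α : ℝ} (hA : SqBound A α) (M : Matrix ι μ ℂ) :
    frobSq (A * M) ≤ α * frobSq M := by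
  rw [frobSq_eq_sum_col, frobSq_eq_sum_col, Finset.mul_sum]
  exact Finset.sum_le_sum fun j _ => hA fun i => M i j

lemma frobSq_mul_transpose_le {B : Matrix κ ι ℂ} {β : ℝ} (hB : SqBound B β) (M : Matrix μ ι ℂ) :
    frobSq (M * Bᵀ) ≤ β * frobSq M := by
  rw [← frobSq_transpose, transpose_mul, transpose_transpose, ← frobSq_transpose M]
  exact frobSq_mul_le hB _

lemma normSq_eq_frobSq (v : ι × κ → ℂ) : normSq v = frobSq (of fun i k => v (i, k)) := by
  simp [normSq, frobSq, Fintype.sum_prod_type]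

lemma SqBound.kronecker {A : Matrix κ ι ℂ} {B : Matrix μ ν ℂ} {α β : ℝ} (hα : 0 ≤ α)
    (hA : SqBound A α) (hB : SqBound B β) : SqBound (A ⊗ₖ B) (α * β) := by
  intro v
  have h : (of fun i k => (A ⊗ₖ B *ᵥ v) (i, k)) = A * ((of fun i k => v (i, k)) * Bᵀ) := by
    ext i k
    simp only [of_apply, mulVec, dotProduct, Fintype.sum_prod_type, kroneckerMap_apply, mul_apply,
      transpose_apply, Finset.mul_sum]
    exact Finset.sum_congr rfl fun _ _ => Finset.sum_congr rfl fun _ _ => by ring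
  rw [normSq_eq_frobSq, normSq_eq_frobSq v, h, mul_assoc]
  exact (frobSq_mul_le hA _).trans
    (mul_le_mul_of_nonneg_left (frobSq_mul_transpose_le hB _) hα)

lemma SqBound.submatrix_equiv {A : Matrix κ ι ℂ} {α : ℝ} (hA : SqBound A α) (e : ν ≃ ι) :
    SqBound (A.submatrix id e) α := by
  intro v
  have h1 : A.submatrix id e *ᵥ v = A *ᵥ (v ∘ e.symm) := by
    simpa using submatrix_mulVec_equiv A v id e
  have h2 : normSq (v ∘ e.symm) = normSq v :=
    Equiv.sum_comp e.symm fun i => ‖v i‖ ^ 2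
  rw [h1, ← h2]
  exact hA _

lemma sqBound_one [DecidableEq ι] : SqBound (1 : Matrix ι ι ℂ) 1 := fun v => by
  simp

lemma normSq_eq_dotProduct (v : ι → ℂ) : ((normSq v : ℝ) : ℂ) = star v ⬝ᵥ v := by
  simp [normSq, dotProduct, Complex.conj_mul']

lemma normSq_mulVec_of_isometry [DecidableEq ι] {V : Matrix κ ι ℂ} (hV : Vᴴ * V = 1)
    (v : ι → ℂ) : normSq (V *ᵥ v) = normSq v := by
  have h : ((normSq (V *ᵥ v) : ℝ) : ℂ) = normSq v := by
    rw [normSq_eq_dotProduct, normSq_eq_dotProduct, star_mulVec, ← dotProduct_mulVec, mulVec_mulVec,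
      hV, one_mulVec]
  exact_mod_cast h

lemma sqBound_of_isometry [DecidableEq ι] {V : Matrix κ ι ℂ} (hV : Vᴴ * V = 1) : SqBound V 1 :=
  fun v => by rw [normSq_mulVec_of_isometry hV, one_mul]

end Norms

/-! ### Triangular families of operators -/

section Triangular

open Matrix

variable {ι κ μ ν : Type*} [Fintype ι] [Fintype κ] [Fintype μ] [Fintype ν]

/-- The witness `K` is the orthogonal projection onto the kernel of `C`; the norm inequality is
Pythagoras together with `C v = C (v - K v)`. -/
lemma exists_kernel_projection (C : Matrix κ ι ℂ) {α : ℝ} (hC : SqBound C α) :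
    ∃ K : Matrix ι ι ℂ, (∀ v, C *ᵥ v = 0 → K *ᵥ v = v) ∧
      ∀ v, normSq (C *ᵥ v) + α * normSq (K *ᵥ v) ≤ α * normSq v := by
  classical
  let S : Submodule ℂ (EuclideanSpace ℂ ι) :=
    LinearMap.ker (C.mulVecLin ∘ₗ (WithLp.linearEquiv 2 ℂ (ι → ℂ)).toLinearMap)
  let e := WithLp.linearEquiv 2 ℂ (ι → ℂ)
  let L : (ι → ℂ) →ₗ[ℂ] (ι → ℂ) :=
    e.toLinearMap ∘ₗ S.starProjection.toLinearMap ∘ₗ e.symm.toLinearMap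
  have hL : ∀ v, LinearMap.toMatrix' L *ᵥ v = (S.starProjection (WithLp.toLp 2 v)).ofLp := by
    intro v
    rw [LinearMap.toMatrix'_mulVec]
    rfl
  have hn : ∀ w : EuclideanSpace ℂ ι, normSq w.ofLp = ‖w‖ ^ 2 := fun w =>
    (EuclideanSpace.norm_sq_eq w).symm
  refine ⟨LinearMap.toMatrix' L, fun v hv => ?_, fun v => ?_⟩
  · have hmem : WithLp.toLp 2 v ∈ S := hv
    rw [hL, Submodule.starProjection_eq_self_iff.2 hmem]
  · rw [hL]
    set w := WithLp.toLp 2 v with hw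
    have hker : C *ᵥ (S.starProjection w).ofLp = 0 := S.starProjection_apply_mem w
    have hsub : C *ᵥ v = C *ᵥ (w - S.starProjection w).ofLp := by
      rw [WithLp.ofLp_sub, mulVec_sub, hker, sub_zero]
    have hpyth := S.norm_sq_eq_add_norm_sq_starProjection w
    rw [Submodule.starProjection_orthogonal_val] at hpyth
    have hb := hC (w - S.starProjection w).ofLp
    rw [← hsub, hn] at hb
    have hv : normSq v = ‖w‖ ^ 2 := hn w
    rw [hn, hv, hpyth]
    linarith

/-- If the operators `C i` and `D j` annihilate `M` above the diagonal, then the diagonal blocks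
behave as if they were orthogonal pieces of `M`. -/
theorem sum_frobSq_triangular_le {α β : ℝ} (hα : 0 ≤ α) (hβ : 0 ≤ β) :
    ∀ {N : ℕ} (C : Fin N → Matrix κ ι ℂ) (D : Fin N → Matrix ν μ ℂ) (M : Matrix ι μ ℂ),
      (∀ i, SqBound (C i) α) → (∀ i, SqBound (D i) β) →
      (∀ i j, i < j → C i * M * (D j)ᵀ = 0) →
      ∑ i, frobSq (C i * M * (D i)ᵀ) ≤ α * β * frobSq M := by
  intro N
  induction N with
  | zero =>
    intro C D M _ _ _
    simpa using mul_nonneg (mul_nonneg hα hβ) (frobSq_nonneg M)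
  | succ N ih =>
    intro C D M hC hD h
    obtain ⟨K, hK, hnorm⟩ := exists_kernel_projection (C 0) (hC 0)
    -- Passing from `M` to `K * M` does not change the later blocks, because `C 0` kills `M * D j`.
    have hKM : ∀ j : Fin N, K * M * (D j.succ)ᵀ = M * (D j.succ)ᵀ := by
      intro j
      have h0 := h 0 j.succ (Fin.succ_pos j)
      rw [Matrix.mul_assoc] at h0 ⊢
      ext a b
      have hcol : C 0 *ᵥ (fun i => (M * (D j.succ)ᵀ) i b) = 0 := by
        ext c
        exact congrFun (congrFun h0 c) b
      exact congrFun (hK _ hcol) a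
    have hblock : ∀ i j : Fin N,
        C i.succ * (K * M) * (D j.succ)ᵀ = C i.succ * M * (D j.succ)ᵀ := fun i j => by
      rw [Matrix.mul_assoc, hKM, Matrix.mul_assoc]
    have hrest := ih (fun i => C i.succ) (fun i => D i.succ) (K * M) (fun i => hC _)
      (fun i => hD _) (fun i j hij => by
        rw [hblock]
        exact h _ _ (Fin.succ_lt_succ_iff.2 hij))
    simp only [hblock] at hrest
    have hsplit : frobSq (C 0 * M) + α * frobSq (K * M) ≤ α * frobSq M := by
      simp only [frobSq_eq_sum_col, Finset.mul_sum, ← Finset.sum_add_distrib]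
      exact Finset.sum_le_sum fun j _ => hnorm fun i => M i j
    have hfirst := frobSq_mul_transpose_le (hD 0) (C 0 * M)
    rw [Fin.sum_univ_succ]
    nlinarith [mul_le_mul_of_nonneg_left hsplit hβ]

end Triangular

/-! ### Families of operators indexed by transcripts -/

section Blocks

open Matrix

variable {H H' ι κ μ ν : Type*} [Fintype H] [Fintype H'] [Fintype ι] [Fintype κ] [Fintype μ]
  [Fintype ν]

/-- The block row formed by a family of matrices. -/
def blockRow (A : H → Matrix κ ι ℂ) : Matrix κ (H × ι) ℂ := of fun i p => A p.1 i p.2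

lemma blockRow_mulVec {τ : Type*} (A : H → Matrix τ ι ℂ) (v : H × ι → ℂ) :
    blockRow A *ᵥ v = ∑ h, A h *ᵥ fun k => v (h, k) := by
  ext i
  simp [blockRow, mulVec, dotProduct, Fintype.sum_prod_type]

lemma normSq_prod (v : H × ι → ℂ) : normSq v = ∑ h, normSq fun k => v (h, k) := by
  simp [normSq, Fintype.sum_prod_type]

lemma SqBound.blockRow_mul {A : H → Matrix κ ι ℂ} {R : H' → Matrix ι μ ℂ} {α ρ : ℝ} (hα : 0 ≤ α)
    (hA : SqBound (blockRow A) α) (hR : SqBound (blockRow R) ρ) :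
    SqBound (blockRow fun p : H × H' => A p.1 * R p.2) (α * ρ) := by
  intro v
  let w : H × ι → ℂ := fun p => (blockRow R *ᵥ fun s : H' × μ => v ((p.1, s.1), s.2)) p.2
  have h : blockRow (fun p : H × H' => A p.1 * R p.2) *ᵥ v = blockRow A *ᵥ w := by
    rw [blockRow_mulVec, blockRow_mulVec, Fintype.sum_prod_type]
    refine Finset.sum_congr rfl fun h _ => ?_
    have hwh : (fun k => w (h, k)) = ∑ c, R c *ᵥ fun k => v ((h, c), k) :=
      blockRow_mulVec R fun s : H' × μ => v ((h, s.1), s.2)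
    rw [hwh, ← mulVecLin_apply, map_sum]
    refine Finset.sum_congr rfl fun c _ => ?_
    rw [mulVecLin_apply, mulVec_mulVec]
  have hw : normSq w ≤ ρ * normSq v := by
    rw [normSq_prod w, normSq_prod v, Fintype.sum_prod_type, Finset.mul_sum]
    refine Finset.sum_le_sum fun h _ => ?_
    have hb := hR fun s : H' × μ => v ((h, s.1), s.2)
    rw [normSq_prod fun s : H' × μ => v ((h, s.1), s.2)] at hb
    exact hb
  rw [h, mul_assoc]
  exact (hA w).trans (mul_le_mul_of_nonneg_left hw hα)

/-- The factor `2` is the price of putting one qubit on the channel: it is Cauchy–Schwarz over the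
two values of the qubit. -/
lemma sqBound_blockRow_two {V : Fin 2 → Matrix κ ι ℂ} (hV : ∀ c, SqBound (V c) 1) :
    SqBound (blockRow V) 2 := by
  intro v
  rw [blockRow_mulVec, normSq_prod v, Fin.sum_univ_two, Fin.sum_univ_two]
  have h (a b : κ → ℂ) : normSq (a + b) ≤ 2 * (normSq a + normSq b) := by
    simp only [normSq, ← Finset.sum_add_distrib, Finset.mul_sum]
    refine Finset.sum_le_sum fun i _ => ?_
    have h1 := norm_add_le (a i) (b i)
    have h2 := norm_nonneg (a i + b i)
    rw [Pi.add_apply]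
    nlinarith [sq_nonneg (‖a i‖ - ‖b i‖)]
  refine (h _ _).trans ?_
  have h0 := hV 0 fun k => v (0, k)
  have h1 := hV 1 fun k => v (1, k)
  linarith

lemma sqBound_rows {V : Matrix κ ι ℂ} {α : ℝ} (hV : SqBound V α) {f : μ → κ}
    (hf : Function.Injective f) : SqBound (V.submatrix f id) α := by
  classical
  intro v
  refine le_trans ?_ (hV v)
  have h : normSq (V.submatrix f id *ᵥ v) = ∑ k ∈ Finset.univ.map ⟨f, hf⟩, ‖(V *ᵥ v) k‖ ^ 2 := by
    rw [Finset.sum_map]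
    rfl
  rw [h]
  exact Finset.sum_le_sum_of_subset_of_nonneg (Finset.subset_univ _) fun _ _ _ => by positivity

/-- A sum over transcripts is a single product operator applied to the state tensored with the
(unnormalised) maximally entangled state on pairs of transcripts. -/
lemma blockRow_mul_kronecker_mul {τ σ : Type*} [DecidableEq H] (A : H → Matrix τ ι ℂ)
    (B : H → Matrix σ μ ℂ) (M : Matrix ι μ ℂ) :
    blockRow A * ((1 : Matrix H H ℂ) ⊗ₖ M) * (blockRow B)ᵀ = ∑ h, A h * M * (B h)ᵀ := by
  ext i j
  simp only [Matrix.sum_apply, mul_apply, blockRow, of_apply, transpose_apply, Fintype.sum_prod_type,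
    kroneckerMap_apply, one_apply, ite_mul, one_mul, zero_mul, mul_ite, mul_zero]
  refine Finset.sum_congr rfl fun h _ => Finset.sum_congr rfl fun k _ => ?_
  congr 1
  rw [Finset.sum_eq_single h]
  · simp
  · intro h' _ hne
    simp [hne]
  · simp

lemma frobSq_one [DecidableEq H] : frobSq (1 : Matrix H H ℂ) = Fintype.card H := by
  simp [frobSq, one_apply, apply_ite]

end Blocks

/-! ### The amplitudes of a protocol -/

section Protocols

open Matrix

variable {X : Type u} {Y : Type v}

/-- A bipartite vector as a matrix, with Alice's register as the row index. -/
def stateMatrix {m n : ℕ} (ψ : Fin m × Fin n → ℂ) : Matrix (Fin m) (Fin n) ℂ :=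
  of fun a b => ψ (a, b)

lemma alicePuts_apply {m n m' : ℕ} (V : LocalIsometry (Fin m) (Fin m' × Fin 2))
    (ψ : Fin m × Fin n → ℂ) (a : Fin m') (c : Fin 2) (b : Fin n) :
    alicePuts V ψ (a, c, b) = (V.1.submatrix (fun i => (i, c)) id * stateMatrix ψ) a b := by
  simp [alicePuts, stateMatrix, mulVec, dotProduct, Fintype.sum_prod_type, mul_apply, one_apply]

lemma bobPuts_apply {m n n' : ℕ} (W : LocalIsometry (Fin n) (Fin 2 × Fin n'))
    (ψ : Fin m × Fin n → ℂ) (a : Fin m) (c : Fin 2) (b : Fin n') :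
    bobPuts W ψ (a, c, b) = (stateMatrix ψ * (W.1.submatrix (fun i => (c, i)) id)ᵀ) a b := by
  simp [bobPuts, stateMatrix, mulVec, dotProduct, Fintype.sum_prod_type, mul_apply, one_apply,
    mul_comm]

lemma stateMatrix_bobTakes {m n n' : ℕ} (R : LocalIsometry (Fin 2 × Fin n) (Fin n'))
    (φ : Fin m × Fin 2 × Fin n → ℂ) :
    stateMatrix (bobTakes R φ) = ∑ c : Fin 2,
      (of fun a b => φ (a, c, b)) * (R.1.submatrix id fun b => (c, b))ᵀ := by
  ext a b
  simp [bobTakes, stateMatrix, mulVec, dotProduct, Fintype.sum_prod_type, mul_apply, one_apply,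
    Matrix.sum_apply, mul_comm]

lemma stateMatrix_aliceTakes {m n m' : ℕ} (R : LocalIsometry (Fin m × Fin 2) (Fin m'))
    (φ : Fin m × Fin 2 × Fin n → ℂ) :
    stateMatrix (aliceTakes R φ) = ∑ c : Fin 2,
      (R.1.submatrix id fun a => (a, c)) * (of fun a b => φ (a, c, b)) := by
  ext a b
  simp [aliceTakes, stateMatrix, mulVec, dotProduct, Fintype.sum_prod_type, mul_apply, one_apply,
    Matrix.sum_apply]
  exact Finset.sum_add_distrib

lemma sqBound_blockRow_send {κ ι μ : Type} [Fintype κ] [Fintype ι] [DecidableEq ι] [Fintype μ]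
    {V : Matrix κ ι ℂ} (hV : Vᴴ * V = 1) {f : Fin 2 → μ → κ}
    (hf : ∀ c, Function.Injective (f c)) :
    SqBound (blockRow fun c => V.submatrix (f c) id) 2 :=
  sqBound_blockRow_two fun c => sqBound_rows (sqBound_of_isometry hV) (hf c)

lemma sqBound_blockRow_receive {κ ι μ : Type} [Fintype κ] [Fintype ι] [DecidableEq ι] [Fintype μ]
    {R : Matrix κ ι ℂ} (hR : Rᴴ * R = 1) (e : Fin 2 × μ ≃ ι) :
    SqBound (blockRow fun c => R.submatrix id fun b => e (c, b)) 1 :=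
  (sqBound_of_isometry hR).submatrix_equiv e

/-- The function `p` of the inputs and of the shared state (as a matrix) is the squared norm of a sum
of product operators, over an index type `H` of transcripts.  The three factors in the product are
bounds on the squared norms of the block rows of the two parties, and the number of transcripts. -/
def HasAmplitudes {m n : ℕ} (q : ℕ) (p : X → Y → Matrix (Fin m) (Fin n) ℂ → ℝ) : Prop :=
  ∃ (H κ ν : Type) (_ : Fintype H) (_ : Fintype κ) (_ : Fintype ν)
    (A : X → H → Matrix κ (Fin m) ℂ) (B : Y → H → Matrix ν (Fin n) ℂ) (α β : ℝ),
    0 ≤ α ∧ 0 ≤ β ∧ α * β * Fintype.card H ≤ 4 ^ q ∧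
    (∀ x, SqBound (blockRow (A x)) α) ∧ (∀ y, SqBound (blockRow (B y)) β) ∧
    ∀ x y Ψ, p x y Ψ = frobSq (∑ h, A x h * Ψ * (B y h)ᵀ)

lemma hasAmplitudes_one {m n : ℕ} {κ ν : Type} [Fintype κ] [Fintype ν]
    {U : X → Matrix κ (Fin m) ℂ} {W : Y → Matrix ν (Fin n) ℂ}
    (hU : ∀ x, SqBound (U x) 1) (hW : ∀ y, SqBound (W y) 1) :
    HasAmplitudes 1 fun x y (Ψ : Matrix (Fin m) (Fin n) ℂ) => frobSq (U x * Ψ * (W y)ᵀ) := by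
  have punit {κ ι : Type} [Fintype κ] [Fintype ι] {M : Matrix κ ι ℂ} (hM : SqBound M 1) :
      SqBound (blockRow fun _ : Unit => M) 1 := by
    intro v
    rw [blockRow_mulVec, normSq_prod v]
    simpa using hM fun k => v ((), k)
  exact ⟨Unit, κ, ν, inferInstance, inferInstance, inferInstance, fun x _ => U x, fun y _ => W y,
    1, 1, zero_le_one, zero_le_one, by norm_num, fun x => punit (hU x), fun y => punit (hW y),
    fun x y Ψ => by simp⟩

/-- Transmitting a qubit doubles the squared norm of the sender's operators (`a * b = 2`) and the
number of transcripts. -/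
lemma HasAmplitudes.step {m n m' n' q : ℕ} {p : X → Y → Matrix (Fin m') (Fin n') ℂ → ℝ}
    (hp : HasAmplitudes q p) {U : X → Fin 2 → Matrix (Fin m') (Fin m) ℂ}
    {W : Y → Fin 2 → Matrix (Fin n') (Fin n) ℂ} {a b : ℝ} (ha : 0 ≤ a) (hb : 0 ≤ b)
    (hab : a * b = 2) (hU : ∀ x, SqBound (blockRow (U x)) a)
    (hW : ∀ y, SqBound (blockRow (W y)) b) :
    HasAmplitudes (q + 1) fun x y (Ψ : Matrix (Fin m) (Fin n) ℂ) =>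
      p x y (∑ c, U x c * Ψ * (W y c)ᵀ) := by
  obtain ⟨H, κ, ν, _, _, _, A, B, α, β, hα, hβ, hcard, hA, hB, hamp⟩ := hp
  refine ⟨H × Fin 2, κ, ν, inferInstance, inferInstance, inferInstance,
    fun x s => A x s.1 * U x s.2, fun y s => B y s.1 * W y s.2, α * a, β * b,
    mul_nonneg hα ha, mul_nonneg hβ hb, ?_, fun x => (hA x).blockRow_mul hα (hU x),
    fun y => (hB y).blockRow_mul hβ (hW y), fun x y Ψ => ?_⟩
  · rw [Fintype.card_prod, Fintype.card_fin, pow_succ, mul_mul_mul_comm, hab]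
    push_cast
    linarith
  · simp only [hamp, Fintype.sum_prod_type, Matrix.mul_sum, Matrix.sum_mul, transpose_mul,
      Matrix.mul_assoc]

theorem Rounds.exists_hasAmplitudes {q m n : ℕ} (r : Rounds X Y q m n) :
    ∃ p, HasAmplitudes q p ∧ ∀ x y ψ, r.acceptProb x y ψ = p x y (stateMatrix ψ) := by
  have hpair {a : ℕ} (c : Fin 2) : Function.Injective fun i : Fin a => (i, c) :=
    fun _ _ h => (Prod.ext_iff.1 h).1
  have hpair' {a : ℕ} (c : Fin 2) : Function.Injective fun i : Fin a => (c, i) :=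
    fun _ _ h => (Prod.ext_iff.1 h).2
  induction r with
  | aliceLast S =>
    refine ⟨_, hasAmplitudes_one (U := fun x => (S x).1.submatrix (fun i => (i, 1)) id)
      (W := fun _ => 1) (fun x => sqBound_rows (sqBound_of_isometry (S x).2) (hpair 1))
      (fun _ => sqBound_one), fun x y ψ => ?_⟩
    simp [acceptProb, probChannelOne, frobSq, alicePuts_apply]
  | bobLast S =>
    refine ⟨_, hasAmplitudes_one (U := fun _ => 1)
      (W := fun y => (S y).1.submatrix (fun i => (1, i)) id) (fun _ => sqBound_one)
      (fun y => sqBound_rows (sqBound_of_isometry (S y).2) (hpair' 1)), fun x y ψ => ?_⟩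
    simp [acceptProb, probChannelOne, frobSq, bobPuts_apply]
  | aliceSends S R rest ih =>
    obtain ⟨p, hp, hacc⟩ := ih
    refine ⟨_, hp.step (U := fun x c => (S x).1.submatrix (fun i => (i, c)) id)
      (W := fun y c => (R y).1.submatrix id fun b => (c, b)) zero_le_two zero_le_one (mul_one 2)
      (fun x => sqBound_blockRow_send (S x).2 hpair)
      (fun y => sqBound_blockRow_receive (R y).2 (Equiv.refl _)), fun x y ψ => ?_⟩
    have hput : ∀ c, (of fun a b => alicePuts (S x) ψ (a, c, b))
        = (S x).1.submatrix (fun i => (i, c)) id * stateMatrix ψ := fun c => by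
      ext a b
      exact alicePuts_apply (S x) ψ a c b
    simp only [acceptProb, hacc, stateMatrix_bobTakes, hput]
  | bobSends S R rest ih =>
    obtain ⟨p, hp, hacc⟩ := ih
    refine ⟨_, hp.step (U := fun x c => (R x).1.submatrix id fun a => (a, c))
      (W := fun y c => (S y).1.submatrix (fun i => (c, i)) id) zero_le_one zero_le_two (one_mul 2)
      (fun x => sqBound_blockRow_receive (R x).2 (Equiv.prodComm _ _))
      (fun y => sqBound_blockRow_send (S y).2 hpair'), fun x y ψ => ?_⟩
    have hput : ∀ c, (of fun a b => bobPuts (S y) ψ (a, c, b))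
        = stateMatrix ψ * ((S y).1.submatrix (fun i => (c, i)) id)ᵀ := fun c => by
      ext a b
      exact bobPuts_apply (S y) ψ a c b
    simp only [acceptProb, hacc, stateMatrix_aliceTakes, hput, Matrix.mul_assoc]

/-! ### Fooling sets against one-sided protocols -/

theorem card_le_of_computesOneSided {q : ℕ} {f : X × Y → Bool} {F : Finset (X × Y)}
    (hF : IsOneFoolingSet f F) (P : EntangledProtocol X Y q) (hP : P.ComputesOneSided f) :
    (F.card : ℝ) ≤ 2 ^ (4 * q + 2) := by
  classical
  obtain ⟨_, ⟨H, κ, ν, _, _, _, A, B, α, β, hα, hβ, hcard, hA, hB, hprob⟩, hacc⟩ :=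
    P.rounds.exists_hasAmplitudes
  set M := (1 : Matrix H H ℂ) ⊗ₖ stateMatrix P.state with hM
  let T (x : X) (y : Y) : Matrix κ ν ℂ := blockRow (A x) * M * (blockRow (B y))ᵀ
  have hT : ∀ x y, frobSq (T x y) = P.acceptProb x y := fun x y => by
    rw [EntangledProtocol.acceptProb, hacc, hprob, ← blockRow_mul_kronecker_mul]
  have hMnorm : frobSq M = Fintype.card H := by
    have hψ : frobSq (stateMatrix P.state) = 1 := by
      rw [← P.state_norm, stateMatrix, ← normSq_eq_frobSq, normSq]
    rw [hM, frobSq_kronecker, frobSq_one, hψ, mul_one]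
  have hzero : ∀ x y, f (x, y) = false → T x y = 0 := by
    intro x y hxy
    have h := (hP x y).1 hxy
    rw [← hT, frobSq, Finset.sum_eq_zero_iff_of_nonneg
      fun _ _ => Finset.sum_nonneg fun _ _ => by positivity] at h
    ext i j
    have hi := (Finset.sum_eq_zero_iff_of_nonneg fun _ _ => by positivity).1
      (h i (Finset.mem_univ i)) j (Finset.mem_univ j)
    simpa using hi
  let p : Fin F.card → X × Y := fun i => (F.equivFin.symm i : X × Y)
  have hp : ∀ i, p i ∈ F := fun i => (F.equivFin.symm i).2
  have hpinj : Function.Injective p := Subtype.val_injective.comp F.equivFin.symm.injective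
  -- In the second copy of the protocol the two parties exchange their roles, so that the
  -- acceptance amplitude on `(i, j)` is a product of the amplitudes on both crossed inputs.
  let C (i : Fin F.card) := blockRow (A (p i).1) ⊗ₖ blockRow (B (p i).2)
  let D (i : Fin F.card) := blockRow (B (p i).2) ⊗ₖ blockRow (A (p i).1)
  have hCMD : ∀ i j, C i * (M ⊗ₖ Mᵀ) * (D j)ᵀ
      = T (p i).1 (p j).2 ⊗ₖ (T (p j).1 (p i).2)ᵀ := by
    intro i j
    have hD : (D j)ᵀ = (blockRow (B (p j).2))ᵀ ⊗ₖ (blockRow (A (p j).1))ᵀ :=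
      (kroneckerMap_transpose _ _ _).symm
    rw [hD]
    simp only [C, T, ← mul_kronecker_mul, transpose_mul, transpose_transpose, Matrix.mul_assoc]
  have hsum := sum_frobSq_triangular_le (mul_nonneg hα hβ) (mul_nonneg hβ hα) C D (M ⊗ₖ Mᵀ)
    (fun i => (hA _).kronecker hα (hB _)) (fun i => (hB _).kronecker hβ (hA _)) (by
      intro i j hij
      rw [hCMD]
      rcases hF.2 _ (hp i) _ (hp j) (hpinj.ne hij.ne) with h | h
      · rw [hzero _ _ h, zero_kronecker]
      · rw [hzero _ _ h, transpose_zero, kronecker_zero])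
  have hdiag : ∀ i, (1 / 4 : ℝ) ≤ frobSq (C i * (M ⊗ₖ Mᵀ) * (D i)ᵀ) := by
    intro i
    rw [hCMD, frobSq_kronecker, frobSq_transpose, hT]
    have h := (hP (p i).1 (p i).2).2 (hF.1 _ (hp i))
    nlinarith
  have hlow := Finset.sum_le_sum fun i (_ : i ∈ Finset.univ) => hdiag i
  rw [Finset.sum_const, Finset.card_univ, Fintype.card_fin, nsmul_eq_mul] at hlow
  rw [frobSq_kronecker, frobSq_transpose, hMnorm] at hsum
  have hsq : (α * β * Fintype.card H) ^ 2 ≤ ((4 : ℝ) ^ q) ^ 2 :=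
    pow_le_pow_left₀ (by positivity) hcard 2
  have hpow : (2 : ℝ) ^ (4 * q + 2) = 4 * ((4 : ℝ) ^ q) ^ 2 := by
    rw [pow_add, ← pow_mul, show (4 : ℝ) = 2 ^ 2 by norm_num, ← pow_mul, mul_comm]
    congr 2
    ring
  rw [hpow]
  nlinarith

lemma exists_foolingSet_card_eq_fool1 [Finite X] [Finite Y] (f : X × Y → Bool) :
    ∃ F : Finset (X × Y), IsOneFoolingSet f F ∧ F.card = fool1 f := by
  have := Fintype.ofFinite (X × Y)
  refine Nat.sSup_mem (s := {N : ℕ | ∃ F : Finset (X × Y), IsOneFoolingSet f F ∧ F.card = N})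
    ⟨0, ∅, ⟨by simp, by simp⟩, rfl⟩ ⟨Fintype.card (X × Y), ?_⟩
  rintro _ ⟨F, _, rfl⟩
  exact F.card_le_univ

theorem logb_fool1_le_of_computesOneSided [Finite X] [Finite Y] {f : X × Y → Bool} {q : ℕ}
    (P : EntangledProtocol X Y q) (hP : P.ComputesOneSided f) :
    1 / 4 * Real.logb 2 (fool1 f : ℝ) - 1 / 2 ≤ q := by
  obtain ⟨F, hF, hcard⟩ := exists_foolingSet_card_eq_fool1 f
  have h := card_le_of_computesOneSided hF P hP
  rw [hcard] at h
  rcases (fool1 f).eq_zero_or_pos with h0 | h0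
  · have hq : (0 : ℝ) ≤ q := q.cast_nonneg
    rw [h0]
    simp only [Nat.cast_zero, Real.logb_zero]
    linarith
  · have hlog := Real.logb_le_logb_of_le one_lt_two (Nat.cast_pos.2 h0) h
    rw [Real.logb_pow, Real.logb_self_eq_one one_lt_two] at hlog
    push_cast at hlog
    linarith

end Protocols

end QComm

end

theorem mainTheorem2 {X : Type*} {Y : Type*} [Finite X] [Finite Y] (f : X × Y → Bool) :
    ((1 / 4 * Real.logb 2 (QComm.fool1 f : ℝ) - 1 / 2 : ℝ) : EReal) ≤
      (((QComm.Q1star f : ℕ∞) : ENNReal) : EReal) := by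
  set r : ℝ := 1 / 4 * Real.logb 2 (QComm.fool1 f : ℝ) - 1 / 2
  have hceil : ((⌈r⌉₊ : ℕ) : ℕ∞) ≤ QComm.Q1star f := by
    refine le_iInf₂ fun q hq => ?_
    obtain ⟨P, hP⟩ := hq
    exact_mod_cast Nat.ceil_le.2 (QComm.logb_fool1_le_of_computesOneSided P hP)
  have h1 : (r : EReal) ≤ ((⌈r⌉₊ : ℝ) : EReal) := EReal.coe_le_coe_iff.2 (Nat.le_ceil r)
  have h2 : ((((⌈r⌉₊ : ℕ) : ℕ∞) : ENNReal) : EReal) ≤ ((QComm.Q1star f : ENNReal) : EReal) :=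
    EReal.coe_ennreal_le_coe_ennreal_iff.2 (ENat.toENNReal_le.2 hceil)
  refine h1.trans (le_trans (le_of_eq ?_) h2)
  rw [ENat.toENNReal_coe]
  rfl
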